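/- Theorem (Geometric non-degeneracy of $p_\sigma$). Let $M\subset\mathbb{R}^d$ be a compact embedded $C^2$ submanifold (without boundary) of dimension $m\le d$, for instance the compact zero set of a $C^2$ map $h:\mathbb{R}^d\to\mathbb{R}^{d-m}$ whose Jacobian has full rank at every point of $M$, and let $N_zM$ denote the normal space of $M$ at $z\in M$. Let $p_0:M\to[0,\infty)$ be a Lipschitz probability density with respect to the $m$-dimensional Hausdorff measure $\mathcal{H}^m$ on $M$, let $\mu_0=p_0\,\mathcal{H}^m|_M$, and let $\sigma>0$. Let $Z\sim\mu_0$, let $N$ be conditionally Gaussian given $Z$, with $N\mid Z=z\,\sim\,\mathcal{N}(0,\sigma^2 I_{N_zM})$ on $N_zM$, and let $p_\sigma$ be the law of $X=Z+N$ on $\mathbb{R}^d$. Then: 1. $p_\sigma$ is a (well-defined) probability measure that is absolutely continuous with respect to Lebesgue measure on $\mathbb{R}^d$. 2. For every $j<d$ and every embedded $C^1$ submanifold $S\subset\mathbb{R}^d$ of dimension $j$ (not necessarily closed), $p_\sigma(S)=0$; in particular the support of $p_\sigma$ is not contained in $S$, so $p_\sigma$ is not supported on any lower-dimensional manifold. 3.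 The support of $p_\sigma$ is the union of the affine normal fibers $z+N_zM$ over all $z\in\operatorname{supp}\mu_0$. 4. The support of $p_\sigma$ is everywhere $d$-dimensional: it is the closure of its interior. 5. If $\operatorname{supp}\mu_0=M$, then $\operatorname{supp}p_\sigma=\mathbb{R}^d$. -/

import Mathlib

open MeasureTheory ProbabilityTheory
open scoped NNReal ENNReal

/-- `S` is an embedded `C^n` submanifold of `ℝ^d` of dimension `j` (`n ≥ 1`): near each of its
points it is the zero set of a `C^n` map into `ℝ^(d-j)` whose derivative at the point is onto.
In particular this holds for `{x | h x = 0}` when `h : ℝ^d → ℝ^(d-j)` is `C^n` with a Jacobian of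
full rank at every zero. -/
def IsCkSubmanifold (n : WithTop ℕ∞) {d : ℕ} (j : ℕ) (S : Set (EuclideanSpace ℝ (Fin d))) : Prop :=
  j ≤ d ∧ ∀ x ∈ S, ∃ U : Set (EuclideanSpace ℝ (Fin d)), IsOpen U ∧ x ∈ U ∧
    ∃ h : EuclideanSpace ℝ (Fin d) → EuclideanSpace ℝ (Fin (d - j)),
      ContDiffOn ℝ n h U ∧ Function.Surjective (fderiv ℝ h x) ∧ S ∩ U = {y ∈ U | h y = 0}

/-- The normal space `N_z M`: the orthogonal complement of the tangent space of `M` at `z`, the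
latter being the span of the (two-sided) tangent cone, which for an embedded submanifold and
`z ∈ M` is the tangent space itself. -/
noncomputable def normalSpace {d : ℕ} (M : Set (EuclideanSpace ℝ (Fin d)))
    (z : EuclideanSpace ℝ (Fin d)) : Submodule ℝ (EuclideanSpace ℝ (Fin d)) :=
  (Submodule.span ℝ (tangentConeAt ℝ M z))ᗮ

/-- The law of `z + N` for `N ∼ 𝒩(0, σ² I_{N_z M})`. -/
noncomputable def normalFiberGaussian {d : ℕ} (M : Set (EuclideanSpace ℝ (Fin d))) (σ : ℝ)
    (z : EuclideanSpace ℝ (Fin d)) : Measure (EuclideanSpace ℝ (Fin d)) :=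
  (stdGaussian (normalSpace M z)).map
    (fun w : normalSpace M z => z + σ • (w : EuclideanSpace ℝ (Fin d)))

/-- The law on `ℝ^d` with density `p₀` with respect to the `m`-dimensional Hausdorff measure
on `M`. -/
noncomputable def dataLaw {d : ℕ} (m : ℕ) (M : Set (EuclideanSpace ℝ (Fin d)))
    (p₀ : EuclideanSpace ℝ (Fin d) → ℝ) : Measure (EuclideanSpace ℝ (Fin d)) :=
  ((Measure.hausdorffMeasure (m : ℝ)).restrict M).withDensity (fun x => ENNReal.ofReal (p₀ x))

/-- The perturbed distribution `p_σ`: the law of `X = Z + N`, where `Z ∼ μ₀` and, conditionally on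
`Z = z`, `N ∼ 𝒩(0, σ² I_{N_z M})`; that is, `B ↦ ∫ P(z + N ∈ B | Z = z) dμ₀(z)`. -/
noncomputable def perturbedLaw {d : ℕ} (M : Set (EuclideanSpace ℝ (Fin d)))
    (μ₀ : Measure (EuclideanSpace ℝ (Fin d))) (σ : ℝ) : Measure (EuclideanSpace ℝ (Fin d)) :=
  μ₀.bind (normalFiberGaussian M σ)

/-! ### Gaussian measures -/

/-! Locally, `M` is parametrized by `φ` on an open subset of `ℝ^m`, and the adjoint of `Dh` frames
its normal spaces, so the endpoint map `E(u, t) = φ u + Dh(φ u)† t` parametrizes the union of the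
normal fibers. It is only `C^1`, since `M` is `C^2`, and it may be singular (focal points).

Absolute continuity rests on focal points being negligible. `DE(u, t)` is affine in `t` and
bijective at `t = 0`, where it splits into tangential and normal parts. On each ray `s ↦ s • t` it
is therefore a pencil `T₀ + s T₁` with `T₀` invertible, singular for only finitely many `s`; by
Fubini the singular `t` form a null set in each fiber. Elsewhere `E` is a local diffeomorphism, so
preimages of Lebesgue-null sets are null and almost every fiber Gaussian ignores them
(`ae_volume_slice_endpoint_eq_zero`, `IsCkSubmanifold.ae_normalFiberGaussian_eq_zero`).
Lower-dimensional submanifolds are Lebesgue-null, hence not charged.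

The support is governed by continuity of `z ↦ P_z`, the projection onto `N_z M`: with compactness it
makes the union of fibers closed, and it moves a normal vector to nearby fibers
(`support_perturbedLaw`). Points with `p₀ > 0` are dense in `supp μ₀` and have neighborhoods in `M`
inside it; near a regular point of such a fiber, `E` is open, which produces interior. If `supp μ₀ =
M`, each `x` lies on the fiber over a nearest point of `M`. -/

theorem MeasureTheory.Measure.AbsolutelyContinuous.pi_fin {n : ℕ} {α : Fin n → Type*}
    [∀ i, MeasurableSpace (α i)] {μ ν : ∀ i, Measure (α i)} [∀ i, SigmaFinite (μ i)]
    [∀ i, SigmaFinite (ν i)] (h : ∀ i, μ i ≪ ν i) : Measure.pi μ ≪ Measure.pi ν := by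
  induction n with
  | zero => rw [Measure.pi_of_empty, Measure.pi_of_empty]
  | succ n ih =>
    rw [← (measurePreserving_piFinSuccAbove μ 0).symm.map_eq,
      ← (measurePreserving_piFinSuccAbove ν 0).symm.map_eq]
    exact ((h 0).prod (ih fun i => h _)).map (MeasurableEquiv.measurable _)

section Gaussian

variable {E : Type*} [NormedAddCommGroup E] [InnerProductSpace ℝ E] [FiniteDimensional ℝ E]
  [MeasurableSpace E] [BorelSpace E]

omit [BorelSpace E] in
theorem stdGaussian_eq_map_basis_equiv :
    stdGaussian E = (Measure.pi fun _ => gaussianReal 0 1).map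
      ((stdOrthonormalBasis ℝ E).toBasis.equivFunL.symm) := by
  rw [stdGaussian]
  congr 1
  funext x
  have h := (stdOrthonormalBasis ℝ E).toBasis.equivFun_symm_apply x
  simp only [OrthonormalBasis.coe_toBasis] at h
  exact h.symm

theorem stdGaussian_absolutelyContinuous (ν : Measure E) [ν.IsAddHaarMeasure] :
    stdGaussian E ≪ ν := by
  rw [stdGaussian_eq_map_basis_equiv]
  set e := (stdOrthonormalBasis ℝ E).toBasis.equivFunL.symm
  have h1 : (Measure.pi fun _ : Fin (Module.finrank ℝ E) => gaussianReal 0 1) ≪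
      Measure.pi fun _ => volume :=
    Measure.AbsolutelyContinuous.pi_fin fun _ => gaussianReal_absolutelyContinuous 0 one_ne_zero
  have h2 := h1.map (f := e) e.continuous.measurable
  have : ((Measure.pi fun _ : Fin (Module.finrank ℝ E) => (volume : Measure ℝ)).map
      e).IsAddHaarMeasure := e.isAddHaarMeasure_map _
  exact h2.trans (Measure.absolutelyContinuous_isAddHaarMeasure _ _)

instance isOpenPosMeasure_stdGaussian : (stdGaussian E).IsOpenPosMeasure := by
  rw [stdGaussian_eq_map_basis_equiv]
  have : (gaussianReal 0 1).IsOpenPosMeasure :=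
    (gaussianReal_absolutelyContinuous' 0 one_ne_zero).isOpenPosMeasure
  exact (ContinuousLinearEquiv.continuous _).isOpenPosMeasure_map
    (ContinuousLinearEquiv.surjective _)

/-- For `t ∈ K` the projection does not change the inner product with `t`, so the characteristic
functions agree. -/
theorem stdGaussian_map_orthogonalProjectionOnto (K : Submodule ℝ E) :
    (stdGaussian E).map K.orthogonalProjectionOnto = stdGaussian K := by
  apply Measure.ext_of_charFun
  ext t
  rw [charFun_stdGaussian, charFun_apply, integral_map (by fun_prop) (by fun_prop)]
  have h := charFun_stdGaussian (t : E)
  rw [charFun_apply] at h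
  simpa using h

end Gaussian

/-- The source measure no longer lives on a space depending on `z`; this is what makes measurability
in `z` accessible. -/
theorem normalFiberGaussian_eq_map {d : ℕ} (M : Set (EuclideanSpace ℝ (Fin d))) (σ : ℝ)
    (z : EuclideanSpace ℝ (Fin d)) :
    normalFiberGaussian M σ z = (stdGaussian (EuclideanSpace ℝ (Fin d))).map
      (fun x => z + σ • (normalSpace M z).starProjection x) := by
  rw [normalFiberGaussian, ← stdGaussian_map_orthogonalProjectionOnto,
    Measure.map_map (by fun_prop) (by fun_prop)]
  rfl

instance isProbabilityMeasure_normalFiberGaussian {d : ℕ} (M : Set (EuclideanSpace ℝ (Fin d)))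
    (σ : ℝ) (z : EuclideanSpace ℝ (Fin d)) :
    IsProbabilityMeasure (normalFiberGaussian M σ z) :=
  Measure.isProbabilityMeasure_map (by fun_prop)

theorem normalFiberGaussian_pos_of_isOpen {d : ℕ} {M : Set (EuclideanSpace ℝ (Fin d))} {σ : ℝ}
    (hσ : σ ≠ 0) {z n : EuclideanSpace ℝ (Fin d)} (hn : n ∈ normalSpace M z)
    {O : Set (EuclideanSpace ℝ (Fin d))} (hO : IsOpen O) (hz : z + n ∈ O) :
    0 < normalFiberGaussian M σ z O := by
  rw [normalFiberGaussian, Measure.map_apply (by fun_prop) hO.measurableSet]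
  refine (hO.preimage (by fun_prop)).measure_pos _ ⟨σ⁻¹ • ⟨n, hn⟩, ?_⟩
  simpa [smul_smul, hσ] using hz

theorem normalFiberGaussian_ae_mem {d : ℕ} (M : Set (EuclideanSpace ℝ (Fin d))) (σ : ℝ)
    (z : EuclideanSpace ℝ (Fin d)) :
    ∀ᵐ x ∂normalFiberGaussian M σ z, x - z ∈ normalSpace M z := by
  have hm : MeasurableSet {x : EuclideanSpace ℝ (Fin d) | x - z ∈ normalSpace M z} :=
    ((normalSpace M z).closed_of_finiteDimensional.preimage (by fun_prop)).measurableSet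
  rw [normalFiberGaussian, ae_map_iff (by fun_prop) hm]
  refine .of_forall fun w => ?_
  simpa using (normalSpace M z).smul_mem σ w.2

/-! ### Local parametrizations of submanifolds -/

/-- A local description of `M ⊆ ℝ^d` over the open set `U`: a defining function `h` with onto
derivative, and a parametrization `φ` of `M ∩ U` over the open set `V ⊆ ℝ^m`, with linear left
inverse `π`. -/
structure LocalParam (n : WithTop ℕ∞) {d : ℕ} (m : ℕ) (M : Set (EuclideanSpace ℝ (Fin d))) where
  U : Set (EuclideanSpace ℝ (Fin d))
  h : EuclideanSpace ℝ (Fin d) → EuclideanSpace ℝ (Fin (d - m))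
  V : Set (EuclideanSpace ℝ (Fin m))
  φ : EuclideanSpace ℝ (Fin m) → EuclideanSpace ℝ (Fin d)
  π : EuclideanSpace ℝ (Fin d) →L[ℝ] EuclideanSpace ℝ (Fin m)
  one_le : 1 ≤ n
  le : m ≤ d
  isOpen_U : IsOpen U
  isOpen_V : IsOpen V
  contDiffOn_h : ContDiffOn ℝ n h U
  contDiffOn_φ : ContDiffOn ℝ n φ V
  surjective : ∀ y ∈ U, Function.Surjective (fderiv ℝ h y)
  inter_eq : M ∩ U = {y ∈ U | h y = 0}
  image_eq : φ '' V = M ∩ U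
  π_φ : ∀ u ∈ V, π (φ u) = u

theorem ContinuousLinearMap.isOpen_setOf_bijective {E F : Type*} [NormedAddCommGroup E]
    [NormedSpace ℝ E] [CompleteSpace E] [NormedAddCommGroup F] [NormedSpace ℝ F]
    [CompleteSpace F] : IsOpen {A : E →L[ℝ] F | Function.Bijective A} := by
  have : {A : E →L[ℝ] F | Function.Bijective A} =
      Set.range ((↑) : (E ≃L[ℝ] F) → (E →L[ℝ] F)) := by
    ext A
    constructor
    · intro hA
      exact ⟨ContinuousLinearEquiv.ofBijective A (LinearMap.ker_eq_bot.2 hA.1)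
        (LinearMap.range_eq_top.2 hA.2), ContinuousLinearEquiv.coe_ofBijective _ _ _⟩
    · rintro ⟨e, rfl⟩
      exact e.bijective
  rw [this]
  exact ContinuousLinearEquiv.isOpen

/-- Inverse function theorem for `Φ = (h, π)`, with `π` the orthogonal projection onto `ker Dh(z)`
in coordinates: `Φ` straightens `M` to `{0} × ℝ^m`, and `φ u = Φ⁻¹(0, u)`. -/
theorem IsCkSubmanifold.exists_localParam {n : WithTop ℕ∞} (hn : 1 ≤ n) {d m : ℕ}
    {M : Set (EuclideanSpace ℝ (Fin d))} (hM : IsCkSubmanifold n m M)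
    {z : EuclideanSpace ℝ (Fin d)} (hz : z ∈ M) :
    ∃ L : LocalParam n m M, z ∈ L.U := by
  obtain ⟨hmd, hM⟩ := hM
  obtain ⟨U₀, hU₀, hzU₀, h, hh, hsurj, hMU⟩ := hM z hz
  have hn0 : n ≠ 0 := (zero_lt_one.trans_le hn).ne'
  set A := fderiv ℝ h z with hA
  have hker : Module.finrank ℝ A.ker = m := by
    have h1 := LinearMap.finrank_range_add_finrank_ker A.toLinearMap
    rw [LinearMap.range_eq_top.2 hsurj] at h1
    simp at h1
    omega
  let ι : A.ker ≃L[ℝ] EuclideanSpace ℝ (Fin m) :=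
    ContinuousLinearEquiv.ofFinrankEq (by simp [hker])
  let π : EuclideanSpace ℝ (Fin d) →L[ℝ] EuclideanSpace ℝ (Fin m) :=
    (ι : A.ker →L[ℝ] _).comp A.ker.orthogonalProjectionOnto
  let Φ : EuclideanSpace ℝ (Fin d) → EuclideanSpace ℝ (Fin (d - m)) × EuclideanSpace ℝ (Fin m) :=
    fun y => (h y, π y)
  have hΦ : ContDiffOn ℝ n Φ U₀ := hh.prodMk π.contDiff.contDiffOn
  have hΦ' : ∀ y ∈ U₀, HasFDerivAt Φ ((fderiv ℝ h y).prod π) y := fun y hy =>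
    ((hh.contDiffAt (hU₀.mem_nhds hy)).differentiableAt hn0).hasFDerivAt.prodMk π.hasFDerivAt
  have hinj : Function.Injective (A.prod π) := by
    refine (injective_iff_map_eq_zero _).2 fun x hx => ?_
    obtain ⟨h1, h2⟩ := Prod.ext_iff.1 hx
    have h2' : A.ker.orthogonalProjectionOnto x = 0 := by simpa [π] using h2
    have h3 : (A.ker.orthogonalProjectionOnto x : EuclideanSpace ℝ (Fin d)) = x :=
      A.ker.starProjection_eq_self_iff.2 h1
    rw [← h3, h2', Submodule.coe_zero]
  have hbij : Function.Bijective (A.prod π) := by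
    refine ⟨hinj, ?_⟩
    refine (LinearMap.injective_iff_surjective_of_finrank_eq_finrank
      (f := (A.prod π).toLinearMap) ?_).1 hinj
    simp
    omega
  let e' : EuclideanSpace ℝ (Fin d) ≃L[ℝ] _ :=
    ContinuousLinearEquiv.ofBijective (A.prod π) (LinearMap.ker_eq_bot.2 hbij.1)
      (LinearMap.range_eq_top.2 hbij.2)
  have hcd := hΦ.contDiffAt (hU₀.mem_nhds hzU₀)
  have hfd : HasFDerivAt Φ (e' : EuclideanSpace ℝ (Fin d) →L[ℝ] _) z := hΦ' z hzU₀
  let e := hcd.toOpenPartialHomeomorph Φ hfd hn0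
  -- Bijectivity of `DΦ` throughout `U`, not just at `z`, yields both surjectivity of `Dh` on `U`
  -- and smoothness of the inverse at every relevant point.
  let U : Set (EuclideanSpace ℝ (Fin d)) :=
    (U₀ ∩ fderiv ℝ Φ ⁻¹' {B | Function.Bijective B}) ∩ e.source
  have hU : IsOpen U :=
    ((hΦ.continuousOn_fderiv_of_isOpen hU₀ hn).isOpen_inter_preimage hU₀
      ContinuousLinearMap.isOpen_setOf_bijective).inter e.open_source
  have hzU : z ∈ U := by
    refine ⟨⟨hzU₀, ?_⟩, hcd.mem_toOpenPartialHomeomorph_source hfd hn0⟩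
    rw [Set.mem_preimage, hfd.fderiv]
    exact e'.bijective
  let V : Set (EuclideanSpace ℝ (Fin m)) :=
    (fun u => ((0 : EuclideanSpace ℝ (Fin (d - m))), u)) ⁻¹' (e.target ∩ e.symm ⁻¹' U)
  have hMU' : ∀ y ∈ U, (y ∈ M ↔ h y = 0) := fun y hy => by
    have := Set.ext_iff.1 hMU y
    simpa [hy.1.1] using this
  refine ⟨⟨U, h, V, fun u => e.symm (0, u), π, hn, hmd, hU,
    (e.symm.isOpen_inter_preimage hU).preimage (by fun_prop),
    hh.mono fun y hy => hy.1.1, ?_, ?_, ?_, ?_, ?_⟩, hzU⟩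
  · intro u hu
    have hy : e.symm (0, u) ∈ U := hu.2
    have hb : Function.Bijective (fderiv ℝ Φ (e.symm (0, u))) := hy.1.2
    have h1 : ContDiffAt ℝ n e.symm (0, u) := by
      refine e.contDiffAt_symm (f₀' := ContinuousLinearEquiv.ofBijective
        (fderiv ℝ Φ (e.symm (0, u))) (LinearMap.ker_eq_bot.2 hb.1)
        (LinearMap.range_eq_top.2 hb.2)) hu.1 ?_ (hΦ.contDiffAt (hU₀.mem_nhds hy.1.1))
      exact (hΦ' _ hy.1.1).differentiableAt.hasFDerivAt
    exact (h1.comp u (contDiffAt_const.prodMk contDiffAt_id)).contDiffWithinAt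
  · intro y hy
    have hb : Function.Bijective (fderiv ℝ Φ y) := hy.1.2
    rw [(hΦ' y hy.1.1).fderiv] at hb
    intro w
    obtain ⟨x, hx⟩ := hb.2 (w, 0)
    exact ⟨x, (Prod.ext_iff.1 hx).1⟩
  · ext y
    constructor
    · exact fun hy => ⟨hy.2, (hMU' y hy.2).1 hy.1⟩
    · exact fun hy => ⟨(hMU' y hy.1).2 hy.2, hy.1⟩
  · ext y
    constructor
    · rintro ⟨u, hu, rfl⟩
      have h1 : Φ (e.symm (0, u)) = (0, u) := e.right_inv hu.1
      exact ⟨(hMU' _ hu.2).2 (Prod.ext_iff.1 h1).1, hu.2⟩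
    · rintro ⟨hyM, hyU⟩
      have h1 : e y = (0, π y) := Prod.ext ((hMU' _ hyU).1 hyM) rfl
      have h2 : e.symm (0, π y) = y := by rw [← h1]; exact e.left_inv hyU.2
      refine ⟨π y, ⟨?_, ?_⟩, h2⟩
      · have h3 := e.map_source hyU.2
        rwa [h1] at h3
      · exact Set.mem_preimage.2 (h2.symm ▸ hyU)
  · intro u hu
    have h1 : Φ (e.symm (0, u)) = (0, u) := e.right_inv hu.1
    exact (Prod.ext_iff.1 h1).2

namespace LocalParam

variable {n : WithTop ℕ∞} {d m : ℕ} {M : Set (EuclideanSpace ℝ (Fin d))} (L : LocalParam n m M)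

theorem ne_zero (L : LocalParam n m M) : n ≠ 0 := (zero_lt_one.trans_le L.one_le).ne'

theorem φ_mem {u : EuclideanSpace ℝ (Fin m)} (hu : u ∈ L.V) : L.φ u ∈ M ∩ L.U :=
  L.image_eq ▸ Set.mem_image_of_mem _ hu

theorem hasFDerivAt_φ {u : EuclideanSpace ℝ (Fin m)} (hu : u ∈ L.V) :
    HasFDerivAt L.φ (fderiv ℝ L.φ u) u :=
  ((L.contDiffOn_φ.contDiffAt (L.isOpen_V.mem_nhds hu)).differentiableAt L.ne_zero).hasFDerivAt

theorem hasFDerivAt_h {y : EuclideanSpace ℝ (Fin d)} (hy : y ∈ L.U) :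
    HasFDerivAt L.h (fderiv ℝ L.h y) y :=
  ((L.contDiffOn_h.contDiffAt (L.isOpen_U.mem_nhds hy)).differentiableAt L.ne_zero).hasFDerivAt

theorem π_comp_fderiv_φ {u : EuclideanSpace ℝ (Fin m)} (hu : u ∈ L.V) :
    L.π.comp (fderiv ℝ L.φ u) = .id ℝ _ := by
  refine HasFDerivAt.unique (L.π.hasFDerivAt.comp u (L.hasFDerivAt_φ hu)) ?_
  refine (hasFDerivAt_id u).congr_of_eventuallyEq ?_
  filter_upwards [L.isOpen_V.mem_nhds hu] with v hv using L.π_φ v hv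

theorem fderiv_φ_injective {u : EuclideanSpace ℝ (Fin m)} (hu : u ∈ L.V) :
    Function.Injective (fderiv ℝ L.φ u) :=
  Function.LeftInverse.injective (g := L.π) fun x => by
    simpa using DFunLike.congr_fun (L.π_comp_fderiv_φ hu) x

theorem fderiv_h_comp_fderiv_φ {u : EuclideanSpace ℝ (Fin m)} (hu : u ∈ L.V) :
    (fderiv ℝ L.h (L.φ u)).comp (fderiv ℝ L.φ u) = 0 := by
  refine HasFDerivAt.unique ((L.hasFDerivAt_h (L.φ_mem hu).2).comp u (L.hasFDerivAt_φ hu)) ?_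
  refine (hasFDerivAt_const 0 u).congr_of_eventuallyEq ?_
  filter_upwards [L.isOpen_V.mem_nhds hu] with v hv
  have : L.φ v ∈ {y ∈ L.U | L.h y = 0} := L.inter_eq ▸ L.φ_mem hv
  exact this.2

theorem finrank_ker {y : EuclideanSpace ℝ (Fin d)} (hy : y ∈ L.U) :
    Module.finrank ℝ (fderiv ℝ L.h y).ker = m := by
  have h1 := LinearMap.finrank_range_add_finrank_ker (fderiv ℝ L.h y).toLinearMap
  rw [LinearMap.range_eq_top.2 (L.surjective y hy)] at h1
  have := L.le
  simp at h1
  omega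

theorem range_fderiv_φ {u : EuclideanSpace ℝ (Fin m)} (hu : u ∈ L.V) :
    (fderiv ℝ L.φ u).range = (fderiv ℝ L.h (L.φ u)).ker := by
  refine Submodule.eq_of_le_of_finrank_eq ?_ ?_
  · rintro _ ⟨x, rfl⟩
    exact DFunLike.congr_fun (L.fderiv_h_comp_fderiv_φ hu) x
  · rw [L.finrank_ker (L.φ_mem hu).2]
    simpa using LinearMap.finrank_range_of_inj (f := (fderiv ℝ L.φ u).toLinearMap)
      (L.fderiv_φ_injective hu)

/-- `h` is constant on `M ∩ U`, so `Dh` sends tangent vectors into the tangent cone of a single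
point, which is zero. Conversely the range of `Dφ` is tangent and fills the kernel by dimension. -/
theorem span_tangentConeAt {u : EuclideanSpace ℝ (Fin m)} (hu : u ∈ L.V) :
    Submodule.span ℝ (tangentConeAt ℝ M (L.φ u)) = (fderiv ℝ L.h (L.φ u)).ker := by
  have hz := L.φ_mem hu
  rw [← tangentConeAt_inter_nhds (L.isOpen_U.mem_nhds hz.2)]
  apply le_antisymm
  · rw [Submodule.span_le]
    intro v hv
    have h1 := (L.hasFDerivAt_h hz.2).hasFDerivWithinAt.mapsTo_tangent_cone hv
    have h2 : L.h '' (M ∩ L.U) ⊆ {L.h (L.φ u)} := by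
      have : ∀ y ∈ M ∩ L.U, L.h y = 0 := fun y hy => (L.inter_eq ▸ hy :).2
      rintro _ ⟨y, hy, rfl⟩
      rw [Set.mem_singleton_iff, this y hy, this _ hz]
    have h3 := tangentConeAt_subset_zero (𝕜 := ℝ) (s := {L.h (L.φ u)}) (x := L.h (L.φ u))
      (fun h => by
        obtain ⟨y, hy, hy'⟩ := (accPt_iff_frequently.1 h).exists
        exact hy hy') (tangentConeAt_mono h2 h1)
    exact h3
  · rw [← L.range_fderiv_φ hu, ← L.image_eq]
    rintro _ ⟨x, rfl⟩
    apply Submodule.subset_span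
    refine (L.hasFDerivAt_φ hu).hasFDerivWithinAt.mapsTo_tangent_cone ?_
    rw [tangentConeAt_of_mem_nhds (L.isOpen_V.mem_nhds hu)]
    trivial

theorem normalSpace_φ {u : EuclideanSpace ℝ (Fin m)} (hu : u ∈ L.V) :
    normalSpace M (L.φ u) = (fderiv ℝ L.h (L.φ u)).kerᗮ := by
  rw [normalSpace, L.span_tangentConeAt hu]

theorem normalSpace_eq {z : EuclideanSpace ℝ (Fin d)} (hz : z ∈ M ∩ L.U) :
    normalSpace M z = (fderiv ℝ L.h z).kerᗮ := by
  obtain ⟨u, hu, rfl⟩ := L.image_eq ▸ hz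
  exact L.normalSpace_φ hu

end LocalParam

/-! ### Continuity of the normal projection -/

section Adjoint

open ContinuousLinearMap
open scoped InnerProduct

variable {E F : Type*} [NormedAddCommGroup E] [InnerProductSpace ℝ E] [FiniteDimensional ℝ E]
  [NormedAddCommGroup F] [InnerProductSpace ℝ F] [FiniteDimensional ℝ F]

theorem ContinuousLinearMap.adjoint_injective_of_surjective {A : E →L[ℝ] F}
    (hA : Function.Surjective A) : Function.Injective (A†) := by
  refine (injective_iff_map_eq_zero _).2 fun y hy => ?_
  obtain ⟨x, rfl⟩ := hA y
  have h : inner ℝ ((A†) (A x)) x = 0 := by rw [hy, inner_zero_left]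
  rwa [adjoint_inner_left, inner_self_eq_zero] at h

theorem ContinuousLinearMap.adjoint_apply_mem_ker_orthogonal (A : E →L[ℝ] F) (y : F) :
    (A†) y ∈ A.kerᗮ := by
  rw [Submodule.mem_orthogonal]
  intro x hx
  rw [adjoint_inner_right, show A x = 0 from hx, inner_zero_left]

theorem ContinuousLinearMap.isUnit_comp_adjoint {A : E →L[ℝ] F}
    (hA : Function.Surjective A) : IsUnit (A ∘L A†) := by
  have hinj : Function.Injective (A ∘L A†) := by
    refine (injective_iff_map_eq_zero _).2 fun y hy => ?_
    apply adjoint_injective_of_surjective hA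
    rw [map_zero, ← inner_self_eq_zero (𝕜 := ℝ), adjoint_inner_left]
    rw [show A ((A†) y) = 0 from hy, inner_zero_right]
  rw [isUnit_iff_bijective]
  exact ⟨hinj, (LinearMap.injective_iff_surjective (f := (A ∘L A†).toLinearMap)).1 hinj⟩

/-- The explicit formula `A†(AA†)⁻¹A` shows that the projection depends continuously on `A` wherever
`A` is onto. -/
theorem ContinuousLinearMap.starProjection_ker_orthogonal {A : E →L[ℝ] F}
    (hA : Function.Surjective A) :
    A.kerᗮ.starProjection = A† ∘L Ring.inverse (A ∘L A†) ∘L A := by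
  ext u
  apply Submodule.eq_starProjection_of_mem_of_inner_eq_zero
  · exact adjoint_apply_mem_ker_orthogonal A _
  · intro w hw
    refine hw _ ?_
    have h1 : (A ∘L A†) (Ring.inverse (A ∘L A†) (A u)) = A u :=
      DFunLike.congr_fun (Ring.mul_inverse_cancel _ (isUnit_comp_adjoint hA)) (A u)
    change A (u - (A†) (Ring.inverse (A ∘L A†) (A u))) = 0
    rw [map_sub, sub_eq_zero]
    exact h1.symm

theorem ContinuousLinearMap.range_adjoint_eq {A : E →L[ℝ] F} (hA : Function.Surjective A) :
    (A†).range = A.kerᗮ := by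
  apply le_antisymm
  · rintro _ ⟨y, rfl⟩
    exact adjoint_apply_mem_ker_orthogonal A y
  · intro w hw
    rw [← A.kerᗮ.starProjection_eq_self_iff.2 hw, starProjection_ker_orthogonal hA]
    exact ⟨_, rfl⟩

theorem ContinuousLinearMap.continuousAt_starProjection_ker_orthogonal {A : E →L[ℝ] F}
    (hA : Function.Surjective A) :
    ContinuousAt (fun A : E →L[ℝ] F => A† ∘L Ring.inverse (A ∘L A†) ∘L A) A := by
  have hadj : ContinuousAt (fun A : E →L[ℝ] F => A†) A :=
    (LinearIsometryEquiv.continuous _).continuousAt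
  obtain ⟨G, hG⟩ := isUnit_comp_adjoint hA
  have hinv : ContinuousAt (fun A : E →L[ℝ] F => Ring.inverse (A ∘L A†)) A :=
    ContinuousAt.comp (g := Ring.inverse) (hG ▸ NormedRing.inverse_continuousAt G)
      (continuousAt_id.clm_comp hadj)
  exact hadj.clm_comp (hinv.clm_comp continuousAt_id)

end Adjoint

theorem IsCkSubmanifold.continuousOn_starProjection_normalSpace {d m : ℕ}
    {M : Set (EuclideanSpace ℝ (Fin d))} (hM : IsCkSubmanifold 1 m M) :
    ContinuousOn (fun z => (normalSpace M z).starProjection) M := by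
  intro z hz
  obtain ⟨L, hL⟩ := hM.exists_localParam le_rfl hz
  have h1 : ContinuousAt (fderiv ℝ L.h) z :=
    (L.contDiffOn_h.continuousOn_fderiv_of_isOpen L.isOpen_U le_rfl).continuousAt
      (L.isOpen_U.mem_nhds hL)
  have h2 := (ContinuousAt.comp
    (ContinuousLinearMap.continuousAt_starProjection_ker_orthogonal (L.surjective z hL)) h1)
  refine (h2.continuousWithinAt (s := M)).congr_of_eventuallyEq_of_mem ?_ hz
  filter_upwards [inter_mem_nhdsWithin M (L.isOpen_U.mem_nhds hL)] with y hy
  simp only [Function.comp_apply]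
  rw [← ContinuousLinearMap.starProjection_ker_orthogonal (L.surjective y hy.2)]
  simp only [L.normalSpace_eq hy]

theorem IsCkSubmanifold.of_le {n n' : WithTop ℕ∞} (hn : n' ≤ n) {d m : ℕ}
    {M : Set (EuclideanSpace ℝ (Fin d))} (hM : IsCkSubmanifold n m M) :
    IsCkSubmanifold n' m M := by
  refine ⟨hM.1, fun x hx => ?_⟩
  obtain ⟨U, hU, hxU, h, hh, h'⟩ := hM.2 x hx
  exact ⟨U, hU, hxU, h, hh.of_le hn, h'⟩

theorem aemeasurable_normalFiberGaussian {d m : ℕ} {M : Set (EuclideanSpace ℝ (Fin d))}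
    (hM : IsCkSubmanifold 1 m M) (hmeas : MeasurableSet M) (σ : ℝ)
    {ν : Measure (EuclideanSpace ℝ (Fin d))} (hν : ∀ᵐ z ∂ν, z ∈ M) :
    AEMeasurable (normalFiberGaussian M σ) ν := by
  classical
  -- The projection is controlled only on `M`; the value `0` elsewhere makes `P` globally measurable
  -- without affecting `ν`-almost every fiber.
  let P : EuclideanSpace ℝ (Fin d) → EuclideanSpace ℝ (Fin d) →L[ℝ] EuclideanSpace ℝ (Fin d) :=
    M.piecewise (fun z => (normalSpace M z).starProjection) 0
  have hP : Measurable P :=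
    hM.continuousOn_starProjection_normalSpace.measurable_piecewise continuousOn_const hmeas
  have hf : Measurable fun p : EuclideanSpace ℝ (Fin d) × EuclideanSpace ℝ (Fin d) =>
      p.1 + σ • P p.1 p.2 := by
    have h1 : Measurable fun p : EuclideanSpace ℝ (Fin d) × EuclideanSpace ℝ (Fin d) =>
        P p.1 p.2 :=
      (isBoundedBilinearMap_apply (𝕜 := ℝ) (E := EuclideanSpace ℝ (Fin d))
        (F := EuclideanSpace ℝ (Fin d))).continuous.measurable.comp
        ((hP.comp measurable_fst).prodMk measurable_snd)
    fun_prop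
  refine ⟨fun z => (stdGaussian (EuclideanSpace ℝ (Fin d))).map fun x => z + σ • P z x, ?_, ?_⟩
  · refine Measure.measurable_of_measurable_coe _ fun s hs => ?_
    have : ∀ z, (stdGaussian (EuclideanSpace ℝ (Fin d))).map (fun x => z + σ • P z x) s =
        stdGaussian (EuclideanSpace ℝ (Fin d))
          (Prod.mk z ⁻¹' ((fun p : EuclideanSpace ℝ (Fin d) × EuclideanSpace ℝ (Fin d) =>
            p.1 + σ • P p.1 p.2) ⁻¹' s)) := fun z =>
      Measure.map_apply (by fun_prop) hs
    simp_rw [this]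
    exact measurable_measure_prodMk_left (hf hs)
  · filter_upwards [hν] with z hz
    rw [normalFiberGaussian_eq_map]
    simp [P, hz]

/-! ### Null sets under differentiable maps -/

section Null

variable {E F : Type*} [NormedAddCommGroup E] [NormedSpace ℝ E] [FiniteDimensional ℝ E]
  [MeasurableSpace E] [BorelSpace E] [NormedAddCommGroup F] [NormedSpace ℝ F]
  [FiniteDimensional ℝ F] [MeasurableSpace F] [BorelSpace F]

/-- Locally the preimage is the image of part of `B` under a Lipschitz local inverse, and Haar-null
means null for the Hausdorff measure of full dimension. -/
theorem measure_inter_preimage_eq_zero_of_bijective_fderiv {f : E → F} {s : Set E} {B : Set F}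
    (μ : Measure E) [μ.IsAddHaarMeasure] (ν : Measure F) [ν.IsAddHaarMeasure] (hB : ν B = 0)
    (hf : ∀ x ∈ s, ∃ f' : E →L[ℝ] F, HasStrictFDerivAt f f' x ∧ Function.Bijective f') :
    μ (s ∩ f ⁻¹' B) = 0 := by
  refine measure_null_of_locally_null _ fun x hx => ?_
  obtain ⟨f', hf', hbij⟩ := hf x hx.1
  let e := ContinuousLinearEquiv.ofBijective f' (LinearMap.ker_eq_bot.2 hbij.1)
    (LinearMap.range_eq_top.2 hbij.2)
  have he : HasStrictFDerivAt f (e : E →L[ℝ] F) x := hf'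
  obtain ⟨K, t, ht, hK⟩ := he.to_localInverse.exists_lipschitzOnWith
  refine ⟨{y | he.localInverse f e x (f y) = y} ∩ f ⁻¹' t ∩ (s ∩ f ⁻¹' B),
    Filter.inter_mem (mem_nhdsWithin_of_mem_nhds (Filter.inter_mem he.eventually_left_inverse
      (hf'.continuousAt ht))) self_mem_nhdsWithin, ?_⟩
  have hB' : Measure.hausdorffMeasure (Module.finrank ℝ F : ℝ) B = 0 :=
    Measure.absolutelyContinuous_isAddHaarMeasure _ ν hB
  have h0 : Measure.hausdorffMeasure (Module.finrank ℝ E : ℝ)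
      (he.localInverse f e x '' (B ∩ t)) = 0 := by
    rw [e.toLinearEquiv.finrank_eq]
    refine le_antisymm (((hK.mono Set.inter_subset_right).hausdorffMeasure_image_le
      (Nat.cast_nonneg _)).trans ?_) zero_le
    rw [measure_mono_null Set.inter_subset_left hB', mul_zero]
  refine Measure.absolutelyContinuous_isAddHaarMeasure μ
    (Measure.hausdorffMeasure (Module.finrank ℝ E : ℝ)) (measure_mono_null ?_ h0)
  rintro y ⟨⟨hy1, hy2⟩, -, hy3⟩
  exact ⟨f y, ⟨hy3, hy2⟩, hy1⟩

omit [FiniteDimensional ℝ F] in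
theorem hausdorffMeasure_image_eq_zero_of_contDiffAt {f : E → F} {s : Set E} (μ : Measure E)
    [μ.IsAddHaarMeasure] (hs : μ s = 0) (hf : ∀ x ∈ s, ContDiffAt ℝ 1 f x) :
    Measure.hausdorffMeasure (Module.finrank ℝ E : ℝ) (f '' s) = 0 := by
  have hs' : Measure.hausdorffMeasure (Module.finrank ℝ E : ℝ) s = 0 :=
    Measure.absolutelyContinuous_isAddHaarMeasure _ μ hs
  -- Pulling back the outer measure turns nullity of the image into a local statement about `s`.
  have h := measure_null_of_locally_null (μ := OuterMeasure.comap f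
    (Measure.hausdorffMeasure (Module.finrank ℝ E : ℝ)).toOuterMeasure) s fun x hx => by
      obtain ⟨K, t, ht, hK⟩ := (hf x hx).exists_lipschitzOnWith
      refine ⟨t ∩ s, Filter.inter_mem (mem_nhdsWithin_of_mem_nhds ht) self_mem_nhdsWithin, ?_⟩
      rw [OuterMeasure.comap_apply]
      refine le_antisymm (((hK.mono Set.inter_subset_left).hausdorffMeasure_image_le
        (Nat.cast_nonneg _)).trans ?_) zero_le
      rw [measure_mono_null Set.inter_subset_right hs', mul_zero]
  exact h

end Null

/-- Local parametrizations are locally Lipschitz, so each piece has Hausdorff dimension at most `j <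
d`. -/
theorem IsCkSubmanifold.volume_eq_zero {d j : ℕ} (hj : j < d)
    {S : Set (EuclideanSpace ℝ (Fin d))} (hS : IsCkSubmanifold 1 j S) : volume S = 0 := by
  refine measure_null_of_locally_null _ fun x hx => ?_
  obtain ⟨L, hL⟩ := hS.exists_localParam le_rfl hx
  refine ⟨S ∩ L.U, inter_mem_nhdsWithin S (L.isOpen_U.mem_nhds hL), ?_⟩
  rw [← L.image_eq]
  have h1 : dimH (L.φ '' L.V) ≤ dimH L.V := dimH_image_le_of_locally_lipschitzOn fun u hu => by
    obtain ⟨K, t, ht, hK⟩ :=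
      (L.contDiffOn_φ.contDiffAt (L.isOpen_V.mem_nhds hu)).exists_lipschitzOnWith
    exact ⟨K, t, mem_nhdsWithin_of_mem_nhds ht, hK⟩
  have h2 : dimH (L.φ '' L.V) < ((d : ℝ≥0) : ℝ≥0∞) := by
    refine (h1.trans (dimH_mono (Set.subset_univ _))).trans_lt ?_
    rw [Real.dimH_univ_eq_finrank]
    simpa using hj
  have h3 := hausdorffMeasure_of_dimH_lt h2
  have h4 : (volume : Measure (EuclideanSpace ℝ (Fin d))) ≪
      Measure.hausdorffMeasure (Module.finrank ℝ (EuclideanSpace ℝ (Fin d)) : ℝ) :=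
    Measure.absolutelyContinuous_isAddHaarMeasure _ _
  refine h4 ?_
  simpa using h3

/-! ### Pencils of linear maps and radially thin sets -/

/-- A nonzero kernel vector of `T₀ + s T₁` is an eigenvector of `T₀⁻¹ T₁` with eigenvalue `-s⁻¹`,
and there are finitely many eigenvalues. -/
theorem LinearMap.finite_setOf_not_injective_add_smul {X Y : Type*} [AddCommGroup X] [Module ℝ X]
    [FiniteDimensional ℝ X] [AddCommGroup Y] [Module ℝ Y] (T₀ T₁ : X →ₗ[ℝ] Y)
    (h : Function.Bijective T₀) : {s : ℝ | ¬ Function.Injective (T₀ + s • T₁)}.Finite := by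
  let e := LinearEquiv.ofBijective T₀ h
  let g : Module.End ℝ X := e.symm.toLinearMap ∘ₗ T₁
  refine ((Module.End.finite_hasEigenvalue g).image fun μ => -μ⁻¹).subset fun s hs => ?_
  have hs' : ¬ Function.Injective (T₀ + s • T₁) := hs
  rw [injective_iff_map_eq_zero] at hs'
  push Not at hs'
  obtain ⟨x, hx, hx0⟩ := hs'
  have h1 : x + s • g x = 0 := by
    apply h.1
    rw [map_add, map_smul, map_zero, show T₀ (g x) = T₁ x from e.apply_symm_apply (T₁ x)]
    exact hx
  have hs0 : s ≠ 0 := by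
    rintro rfl
    apply hx0
    simpa using h1
  refine ⟨-s⁻¹, Module.End.hasEigenvalue_of_hasEigenvector (x := x)
    ⟨Module.End.mem_eigenspace_iff.2 ?_, hx0⟩, by simp⟩
  rw [add_comm] at h1
  rw [neg_smul, ← smul_neg, ← eq_neg_of_add_eq_zero_left h1, smul_smul, inv_mul_cancel₀ hs0,
    one_smul]

/-- Fubini for `(s, t) ↦ s • t` gives some `s ≠ 0` for which the preimage of `D` under scaling by
`s` is null; scaling back, so is `D`. -/
theorem measure_eq_zero_of_countable_radial {F : Type*} [NormedAddCommGroup F] [NormedSpace ℝ F]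
    [FiniteDimensional ℝ F] [MeasurableSpace F] [BorelSpace F] (μ : Measure F)
    [μ.IsAddHaarMeasure] {D : Set F} (hD : MeasurableSet D)
    (h : ∀ t : F, {s : ℝ | s • t ∈ D}.Countable) : μ D = 0 := by
  have h1 : ∀ᵐ s : ℝ, ∀ᵐ t ∂μ, s • t ∉ D := by
    refine (Measure.ae_ae_comm (p := fun (t : F) (s : ℝ) => s • t ∉ D) ?_).1 ?_
    · have hm : Measurable fun p : F × ℝ => p.2 • p.1 := measurable_snd.smul measurable_fst
      exact (hm hD).compl
    · refine .of_forall fun t => ?_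
      rw [ae_iff]
      simpa using (h t).measure_zero volume
  have h2 : ∀ᵐ s : ℝ, s ≠ 0 := by simp [ae_iff]
  obtain ⟨s, hs, hs0⟩ := (h1.and h2).exists
  have h3 : μ ((s • ·) ⁻¹' D) = 0 := by
    rw [← compl_mem_ae_iff]
    filter_upwards [hs] with t ht using ht
  rw [Measure.addHaar_preimage_smul μ hs0] at h3
  refine (mul_eq_zero.1 h3).resolve_left ?_
  simp [hs0]

/-! ### The endpoint map of the normal bundle in local coordinates -/

/-- The adjoint as a linear map between spaces of continuous linear maps. -/
noncomputable def adjointCLM (E F : Type*) [NormedAddCommGroup E] [InnerProductSpace ℝ E]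
    [FiniteDimensional ℝ E] [NormedAddCommGroup F] [InnerProductSpace ℝ F]
    [FiniteDimensional ℝ F] : (E →L[ℝ] F) →L[ℝ] (F →L[ℝ] E) :=
  LinearMap.toContinuousLinearMap
    { toFun := fun A => ContinuousLinearMap.adjoint A
      map_add' := fun A B => map_add _ A B
      map_smul' := fun c A => by simp }

namespace LocalParam

variable {d m : ℕ} {M : Set (EuclideanSpace ℝ (Fin d))} (L : LocalParam 2 m M)

/-- A frame of the normal spaces along the parametrization. -/
noncomputable def frame (u : EuclideanSpace ℝ (Fin m)) :
    EuclideanSpace ℝ (Fin (d - m)) →L[ℝ] EuclideanSpace ℝ (Fin d) :=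
  adjointCLM _ _ (fderiv ℝ L.h (L.φ u))

/-- The endpoint map `(u, t) ↦ φ u + Dh(φ u)† t` of the normal bundle. -/
noncomputable def endpoint
    (p : EuclideanSpace ℝ (Fin m) × EuclideanSpace ℝ (Fin (d - m))) :
    EuclideanSpace ℝ (Fin d) :=
  L.φ p.1 + L.frame p.1 p.2

theorem frame_injective {u : EuclideanSpace ℝ (Fin m)} (hu : u ∈ L.V) :
    Function.Injective (L.frame u) :=
  ContinuousLinearMap.adjoint_injective_of_surjective (L.surjective _ (L.φ_mem hu).2)

theorem range_frame {u : EuclideanSpace ℝ (Fin m)} (hu : u ∈ L.V) :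
    (L.frame u).range = normalSpace M (L.φ u) := by
  rw [L.normalSpace_φ hu]
  exact ContinuousLinearMap.range_adjoint_eq (L.surjective _ (L.φ_mem hu).2)

theorem contDiffOn_frame : ContDiffOn ℝ 1 L.frame L.V := by
  have h1 : ContDiffOn ℝ 1 (fderiv ℝ L.h) L.U :=
    L.contDiffOn_h.fderiv_of_isOpen L.isOpen_U (by norm_num)
  exact (adjointCLM _ _).contDiff.comp_contDiffOn
    (h1.comp (L.contDiffOn_φ.of_le (by norm_num)) fun u hu => (L.φ_mem hu).2)

theorem contDiffOn_endpoint : ContDiffOn ℝ 1 L.endpoint (L.V ×ˢ Set.univ) := by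
  have h1 : ContDiffOn ℝ 1 (fun p : EuclideanSpace ℝ (Fin m) × EuclideanSpace ℝ (Fin (d - m)) =>
      L.φ p.1) (L.V ×ˢ Set.univ) :=
    (L.contDiffOn_φ.of_le (by norm_num)).comp contDiff_fst.contDiffOn fun p hp => hp.1
  have h2 : ContDiffOn ℝ 1 (fun p : EuclideanSpace ℝ (Fin m) × EuclideanSpace ℝ (Fin (d - m)) =>
      L.frame p.1) (L.V ×ˢ Set.univ) :=
    L.contDiffOn_frame.comp contDiff_fst.contDiffOn fun p hp => hp.1
  exact h1.add (h2.clm_apply contDiff_snd.contDiffOn)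

theorem isOpen_prod : IsOpen (L.V ×ˢ (Set.univ : Set (EuclideanSpace ℝ (Fin (d - m))))) :=
  L.isOpen_V.prod isOpen_univ

theorem fderiv_endpoint_apply {u : EuclideanSpace ℝ (Fin m)} (hu : u ∈ L.V)
    (t : EuclideanSpace ℝ (Fin (d - m)))
    (w : EuclideanSpace ℝ (Fin m) × EuclideanSpace ℝ (Fin (d - m))) :
    fderiv ℝ L.endpoint (u, t) w =
      fderiv ℝ L.φ u w.1 + L.frame u w.2 + fderiv ℝ L.frame u w.1 t := by
  have hfr : HasFDerivAt L.frame (fderiv ℝ L.frame u) u :=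
    ((L.contDiffOn_frame.contDiffAt (L.isOpen_V.mem_nhds hu)).differentiableAt
      one_ne_zero).hasFDerivAt
  have h1 := (HasFDerivAt.comp (u, t) (f := Prod.fst) (L.hasFDerivAt_φ hu) hasFDerivAt_fst).add
    ((HasFDerivAt.comp (u, t) (f := Prod.fst) hfr hasFDerivAt_fst).clm_apply
      (hasFDerivAt_snd (p := (u, t))))
  have h2 : HasFDerivAt L.endpoint _ (u, t) := h1
  rw [h2.fderiv]
  simp [add_assoc]

theorem bijective_fderiv_endpoint_iff {u : EuclideanSpace ℝ (Fin m)}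
    {t : EuclideanSpace ℝ (Fin (d - m))} :
    Function.Bijective (fderiv ℝ L.endpoint (u, t)) ↔
      Function.Injective (fderiv ℝ L.endpoint (u, t)) := by
  refine ⟨fun h => h.1, fun h => ⟨h, ?_⟩⟩
  refine (LinearMap.injective_iff_surjective_of_finrank_eq_finrank
    (f := (fderiv ℝ L.endpoint (u, t)).toLinearMap) ?_).1 h
  have := L.le
  simp
  omega

theorem injective_fderiv_endpoint_zero {u : EuclideanSpace ℝ (Fin m)} (hu : u ∈ L.V) :
    Function.Injective (fderiv ℝ L.endpoint (u, 0)) := by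
  refine (injective_iff_map_eq_zero _).2 fun w hw => ?_
  rw [L.fderiv_endpoint_apply hu, map_zero, add_zero] at hw
  have h1 : fderiv ℝ L.φ u w.1 ∈ (fderiv ℝ L.h (L.φ u)).ker := by
    rw [← L.range_fderiv_φ hu]
    exact ⟨_, rfl⟩
  have h2 : L.frame u w.2 ∈ (fderiv ℝ L.h (L.φ u)).kerᗮ :=
    ContinuousLinearMap.adjoint_apply_mem_ker_orthogonal _ _
  have h3 : fderiv ℝ L.φ u w.1 = 0 := by
    rw [← inner_self_eq_zero (𝕜 := ℝ)]
    nth_rewrite 2 [eq_neg_of_add_eq_zero_left hw]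
    rw [inner_neg_right, h2 _ h1, neg_zero]
  rw [h3, zero_add] at hw
  exact Prod.ext (L.fderiv_φ_injective hu (h3.trans (map_zero _).symm))
    (L.frame_injective hu (hw.trans (map_zero _).symm))

/-- Each line through the base point of a normal fiber meets only finitely many focal points: the
derivative along it is a linear pencil, invertible at `s = 0`. -/
theorem finite_setOf_not_bijective_fderiv_endpoint {u : EuclideanSpace ℝ (Fin m)} (hu : u ∈ L.V)
    (t : EuclideanSpace ℝ (Fin (d - m))) :
    {s : ℝ | ¬ Function.Bijective (fderiv ℝ L.endpoint (u, s • t))}.Finite := by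
  let T₁ : EuclideanSpace ℝ (Fin m) × EuclideanSpace ℝ (Fin (d - m)) →ₗ[ℝ]
      EuclideanSpace ℝ (Fin d) :=
    ((ContinuousLinearMap.apply ℝ (EuclideanSpace ℝ (Fin d)) t).comp
      ((fderiv ℝ L.frame u).comp (ContinuousLinearMap.fst ℝ _ _))).toLinearMap
  have h0 := L.bijective_fderiv_endpoint_iff.2 (L.injective_fderiv_endpoint_zero hu)
  refine (LinearMap.finite_setOf_not_injective_add_smul
    (fderiv ℝ L.endpoint (u, 0)).toLinearMap T₁ h0).subset fun s hs hinj => ?_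
  refine hs (L.bijective_fderiv_endpoint_iff.2 ?_)
  convert hinj using 1
  funext w
  simp [T₁, L.fderiv_endpoint_apply hu]

theorem isOpen_setOf_bijective_fderiv_endpoint :
    IsOpen ((L.V ×ˢ Set.univ) ∩ {p | Function.Bijective (fderiv ℝ L.endpoint p)}) :=
  (L.contDiffOn_endpoint.continuousOn_fderiv_of_isOpen L.isOpen_prod le_rfl).isOpen_inter_preimage
    L.isOpen_prod ContinuousLinearMap.isOpen_setOf_bijective

theorem ae_volume_slice_endpoint_eq_zero {B : Set (EuclideanSpace ℝ (Fin d))}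
    (hB : volume B = 0) :
    ∀ᵐ u : EuclideanSpace ℝ (Fin m), u ∈ L.V →
      volume {t : EuclideanSpace ℝ (Fin (d - m)) | L.endpoint (u, t) ∈ B} = 0 := by
  set G := (L.V ×ˢ Set.univ) ∩ {p | Function.Bijective (fderiv ℝ L.endpoint p)} with hG
  have h1 : (volume.prod volume) (G ∩ L.endpoint ⁻¹' B) = 0 :=
    measure_inter_preimage_eq_zero_of_bijective_fderiv (volume.prod volume) volume hB
      fun p hp => ⟨fderiv ℝ L.endpoint p, (L.contDiffOn_endpoint.contDiffAt
        (L.isOpen_prod.mem_nhds hp.1)).hasStrictFDerivAt one_ne_zero, hp.2⟩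
  filter_upwards [Measure.measure_ae_null_of_prod_null h1] with u hu huV
  have h2 : volume {t : EuclideanSpace ℝ (Fin (d - m)) | (u, t) ∉ G} = 0 := by
    refine measure_eq_zero_of_countable_radial volume
      ((L.isOpen_setOf_bijective_fderiv_endpoint.preimage
        (by fun_prop : Continuous fun t => (u, t))).measurableSet.compl) fun t => ?_
    refine ((L.finite_setOf_not_bijective_fderiv_endpoint huV t).subset fun s hs hb => ?_).countable
    exact hs ⟨⟨huV, trivial⟩, hb⟩
  refine measure_mono_null ?_ (measure_union_null h2 hu)
  intro t ht
  by_cases h : (u, t) ∈ G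
  · exact Or.inr ⟨h, ht⟩
  · exact Or.inl h

theorem normalFiberGaussian_eq_zero {B : Set (EuclideanSpace ℝ (Fin d))}
    (hBm : MeasurableSet B) {σ : ℝ} (hσ : σ ≠ 0) {u : EuclideanSpace ℝ (Fin m)} (hu : u ∈ L.V)
    (hB : volume {t : EuclideanSpace ℝ (Fin (d - m)) | L.endpoint (u, t) ∈ B} = 0) :
    normalFiberGaussian M σ (L.φ u) B = 0 := by
  have hmem : ∀ t, (σ⁻¹ • L.frame u) t ∈ normalSpace M (L.φ u) := fun t =>
    Submodule.smul_mem _ _ (L.range_frame hu ▸ ⟨t, rfl⟩)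
  -- The factor `σ⁻¹` cancels the scaling by `σ`, so that `φ u + σ • Λ₀ t` is exactly `endpoint (u,
  -- t)`.
  let Λ₀ : EuclideanSpace ℝ (Fin (d - m)) →L[ℝ] normalSpace M (L.φ u) :=
    (σ⁻¹ • L.frame u).codRestrict _ hmem
  have hbij : Function.Bijective Λ₀ := by
    constructor
    · intro s t hst
      have h1 : σ⁻¹ • L.frame u s = σ⁻¹ • L.frame u t := congrArg Subtype.val hst
      exact L.frame_injective hu (smul_right_injective _ (inv_ne_zero hσ) h1)
    · rintro ⟨w, hw⟩
      rw [← L.range_frame hu] at hw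
      obtain ⟨t, rfl⟩ := hw
      refine ⟨σ • t, Subtype.ext ?_⟩
      simp [Λ₀, smul_smul, hσ]
  let Λ := ContinuousLinearEquiv.ofBijective Λ₀ (LinearMap.ker_eq_bot.2 hbij.1)
    (LinearMap.range_eq_top.2 hbij.2)
  have := Λ.isAddHaarMeasure_map (volume : Measure (EuclideanSpace ℝ (Fin (d - m))))
  rw [normalFiberGaussian, Measure.map_apply (by fun_prop) hBm]
  refine stdGaussian_absolutelyContinuous (Measure.map Λ volume) ?_
  rw [Measure.map_apply Λ.continuous.measurable
    (hBm.preimage (by fun_prop : Measurable fun w : normalSpace M (L.φ u) =>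
      L.φ u + σ • (w : EuclideanSpace ℝ (Fin d))))]
  convert hB using 2
  ext t
  simp [Λ, Λ₀, endpoint, smul_smul, hσ]

theorem hausdorffMeasure_setOf_normalFiberGaussian_ne_zero
    {B : Set (EuclideanSpace ℝ (Fin d))} (hBm : MeasurableSet B) (hB : volume B = 0)
    {σ : ℝ} (hσ : σ ≠ 0) :
    Measure.hausdorffMeasure (m : ℝ) {z ∈ M ∩ L.U | normalFiberGaussian M σ z B ≠ 0} = 0 := by
  set s := {u ∈ L.V | normalFiberGaussian M σ (L.φ u) B ≠ 0} with hs
  have h1 : volume s = 0 := by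
    refine measure_mono_null (fun u hu => ?_) (ae_iff.1 (L.ae_volume_slice_endpoint_eq_zero hB))
    exact fun h => hu.2 (L.normalFiberGaussian_eq_zero hBm hσ hu.1 (h hu.1))
  have h2 := hausdorffMeasure_image_eq_zero_of_contDiffAt (f := L.φ) volume h1 fun u hu =>
    (L.contDiffOn_φ.contDiffAt (L.isOpen_V.mem_nhds hu.1)).of_le (by norm_num)
  rw [finrank_euclideanSpace_fin] at h2
  refine measure_mono_null ?_ h2
  rintro z ⟨hz, hz'⟩
  obtain ⟨u, hu, rfl⟩ := L.image_eq ▸ hz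
  exact ⟨u, ⟨hu, hz'⟩, rfl⟩

end LocalParam

theorem IsCkSubmanifold.ae_normalFiberGaussian_eq_zero {d m : ℕ}
    {M : Set (EuclideanSpace ℝ (Fin d))} (hM : IsCkSubmanifold 2 m M) (hmeas : MeasurableSet M)
    {B : Set (EuclideanSpace ℝ (Fin d))} (hBm : MeasurableSet B) (hB : volume B = 0)
    {σ : ℝ} (hσ : σ ≠ 0) :
    ∀ᵐ z ∂(Measure.hausdorffMeasure (m : ℝ)).restrict M, normalFiberGaussian M σ z B = 0 := by
  rw [ae_restrict_iff' hmeas, ae_iff]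
  refine measure_null_of_locally_null _ fun z hz => ?_
  have hzM : z ∈ M := by
    by_contra h
    exact hz fun h' => absurd h' h
  obtain ⟨L, hL⟩ := hM.exists_localParam (by norm_num) hzM
  refine ⟨_, inter_mem_nhdsWithin _ (L.isOpen_U.mem_nhds hL), measure_mono_null ?_
    (L.hausdorffMeasure_setOf_normalFiberGaussian_ne_zero hBm hB hσ)⟩
  rintro y ⟨hy, hyU⟩
  have hy' : ¬ (y ∈ M → normalFiberGaussian M σ y B = 0) := hy
  push Not at hy'
  exact ⟨⟨hy'.1, hyU⟩, hy'.2⟩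

/-! ### The data distribution -/

/-- The Lipschitz map `π` sends `M ∩ O` onto a set containing a nonempty open subset of `ℝ^m`. -/
theorem IsCkSubmanifold.hausdorffMeasure_inter_pos {d m : ℕ}
    {M : Set (EuclideanSpace ℝ (Fin d))} (hM : IsCkSubmanifold 1 m M)
    {O : Set (EuclideanSpace ℝ (Fin d))} (hO : IsOpen O) {z : EuclideanSpace ℝ (Fin d)}
    (hz : z ∈ M) (hzO : z ∈ O) : 0 < Measure.hausdorffMeasure (m : ℝ) (M ∩ O) := by
  obtain ⟨L, hL⟩ := hM.exists_localParam le_rfl hz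
  obtain ⟨u, hu, rfl⟩ : z ∈ L.φ '' L.V := L.image_eq ▸ ⟨hz, hL⟩
  have hW : IsOpen (L.V ∩ L.φ ⁻¹' O) :=
    L.contDiffOn_φ.continuousOn.isOpen_inter_preimage L.isOpen_V hO
  have h1 : 0 < Measure.hausdorffMeasure (m : ℝ) (L.V ∩ L.φ ⁻¹' O) := by
    have h := hW.measure_pos (Measure.hausdorffMeasure
      (Module.finrank ℝ (EuclideanSpace ℝ (Fin m)) : ℝ)) ⟨u, hu, hzO⟩
    rwa [finrank_euclideanSpace_fin] at h
  have h2 : L.V ∩ L.φ ⁻¹' O ⊆ L.π '' (M ∩ O) := fun v hv =>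
    ⟨L.φ v, ⟨(L.φ_mem hv.1).1, hv.2⟩, L.π_φ v hv.1⟩
  have h3 := (h1.trans_le (measure_mono h2)).trans_le
    (L.π.lipschitz.hausdorffMeasure_image_le (Nat.cast_nonneg m) _)
  exact (ENNReal.mul_pos_iff.1 h3).2

section dataLaw

variable {d m : ℕ} {M : Set (EuclideanSpace ℝ (Fin d))} {p₀ : EuclideanSpace ℝ (Fin d) → ℝ}

theorem dataLaw_absolutelyContinuous :
    dataLaw m M p₀ ≪ (Measure.hausdorffMeasure (m : ℝ)).restrict M :=
  withDensity_absolutelyContinuous _ _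

theorem ae_mem_dataLaw (hM : MeasurableSet M) : ∀ᵐ z ∂dataLaw m M p₀, z ∈ M :=
  dataLaw_absolutelyContinuous.ae_le (ae_restrict_mem hM)

theorem support_dataLaw_subset (hM : IsClosed M) : (dataLaw m M p₀).support ⊆ M :=
  Measure.support_subset_of_isClosed hM (ae_mem_dataLaw hM.measurableSet)

theorem exists_pos_of_mem_support_dataLaw (hM : MeasurableSet M)
    {z : EuclideanSpace ℝ (Fin d)} (hz : z ∈ (dataLaw m M p₀).support)
    {O : Set (EuclideanSpace ℝ (Fin d))} (hO : IsOpen O) (hzO : z ∈ O) :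
    ∃ y ∈ M ∩ O, 0 < p₀ y := by
  by_contra! h
  refine ((Measure.mem_support_iff_forall z).1 hz O (hO.mem_nhds hzO)).ne' ?_
  rw [dataLaw, withDensity_apply _ hO.measurableSet, Measure.restrict_restrict hO.measurableSet]
  refine (lintegral_congr_ae ?_).trans lintegral_zero
  filter_upwards [ae_restrict_mem (hO.measurableSet.inter hM)] with y hy
  exact ENNReal.ofReal_of_nonpos (h y ⟨hy.2, hy.1⟩)

theorem mem_support_dataLaw_of_pos (hM : IsCkSubmanifold 1 m M) (hmeas : MeasurableSet M)
    (hp₀ : ContinuousOn p₀ M) {z : EuclideanSpace ℝ (Fin d)} (hz : z ∈ M) (hpos : 0 < p₀ z) :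
    z ∈ (dataLaw m M p₀).support := by
  rw [Measure.mem_support_iff_forall]
  intro N hN
  obtain ⟨O₁, hO₁, hzO₁, h₁⟩ := mem_nhdsWithin.1
    ((hp₀ z hz).eventually (lt_mem_nhds (half_lt_self hpos)))
  obtain ⟨O₂, hO₂N, hO₂, hzO₂⟩ := mem_nhds_iff.1 hN
  have hO : IsOpen (O₁ ∩ O₂) := hO₁.inter hO₂
  refine lt_of_lt_of_le ?_ (measure_mono (Set.inter_subset_right.trans hO₂N : O₁ ∩ O₂ ⊆ N))
  rw [dataLaw, withDensity_apply _ hO.measurableSet, Measure.restrict_restrict hO.measurableSet]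
  have h2 := hM.hausdorffMeasure_inter_pos hO hz ⟨hzO₁, hzO₂⟩
  rw [Set.inter_comm] at h2
  refine (ENNReal.mul_pos (ENNReal.ofReal_pos.2 (half_pos hpos)).ne' h2.ne').trans_le ?_
  rw [← setLIntegral_const]
  refine lintegral_mono_ae ?_
  filter_upwards [ae_restrict_mem (hO.measurableSet.inter hmeas)] with y hy
  exact ENNReal.ofReal_le_ofReal (h₁ ⟨hy.1.1, hy.2⟩ : p₀ z / 2 < p₀ y).le

end dataLaw

/-! ### Normal fibers -/

/-- The union of the affine normal fibers of `M` over the points of `K`. -/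
def normalFibers {d : ℕ} (M K : Set (EuclideanSpace ℝ (Fin d))) :
    Set (EuclideanSpace ℝ (Fin d)) :=
  {x | ∃ z ∈ K, ∃ n ∈ normalSpace M z, x = z + n}

section normalFibers

variable {d m : ℕ} {M K : Set (EuclideanSpace ℝ (Fin d))}

theorem mem_normalFibers {x : EuclideanSpace ℝ (Fin d)} :
    x ∈ normalFibers M K ↔ ∃ z ∈ K, x - z ∈ normalSpace M z := by
  constructor
  · rintro ⟨z, hz, n, hn, rfl⟩
    exact ⟨z, hz, by simpa using hn⟩
  · rintro ⟨z, hz, h⟩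
    exact ⟨z, hz, _, h, by simp⟩

/-- The relation `P_z (x - z) = x - z` is closed in `K × ℝ^d`, and projecting along a compact factor
is a closed map. -/
theorem IsCkSubmanifold.isClosed_normalFibers (hM : IsCkSubmanifold 1 m M) (hK : IsCompact K)
    (hKM : K ⊆ M) : IsClosed (normalFibers M K) := by
  have := isCompact_iff_compactSpace.1 hK
  have hP : Continuous fun z : K => (normalSpace M (z : EuclideanSpace ℝ (Fin d))).starProjection :=
    (hM.continuousOn_starProjection_normalSpace.mono hKM).domRestrict
  have hT : IsClosed {p : K × EuclideanSpace ℝ (Fin d) |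
      (normalSpace M (p.1 : EuclideanSpace ℝ (Fin d))).starProjection (p.2 - p.1) = p.2 - p.1} :=
    isClosed_eq ((hP.comp continuous_fst).clm_apply (by fun_prop)) (by fun_prop)
  convert isClosedMap_snd_of_compactSpace _ hT
  ext x
  simp only [mem_normalFibers, Submodule.starProjection_eq_self_iff]
  constructor
  · rintro ⟨z, hz, h⟩
    exact ⟨(⟨z, hz⟩, x), h, rfl⟩
  · rintro ⟨⟨z, y⟩, h, rfl⟩
    exact ⟨z, z.2, h⟩

/-- At a point `z` of `M` nearest to `x`, the first-order condition says that `x - z` is normal. -/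
theorem IsCkSubmanifold.normalFibers_eq_univ (hM : IsCkSubmanifold 1 m M) (hMc : IsCompact M)
    (hne : M.Nonempty) : normalFibers M M = Set.univ := by
  refine Set.eq_univ_of_forall fun x => ?_
  obtain ⟨z, hz, hmin⟩ := hMc.exists_isMinOn hne
    (by fun_prop : ContinuousOn (fun y => ‖x - y‖ ^ 2) M)
  refine mem_normalFibers.2 ⟨z, hz, ?_⟩
  obtain ⟨L, hL⟩ := hM.exists_localParam le_rfl hz
  obtain ⟨u, hu, rfl⟩ : z ∈ L.φ '' L.V := L.image_eq ▸ ⟨hz, hL⟩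
  have h1 : IsLocalMin (fun v => ‖x - L.φ v‖ ^ 2) u := by
    filter_upwards [L.isOpen_V.mem_nhds hu] with v hv using hmin (L.φ_mem hv).1
  have h2 := h1.hasFDerivAt_eq_zero ((L.hasFDerivAt_φ hu).const_sub x).norm_sq
  rw [L.normalSpace_φ hu, ← L.range_fderiv_φ hu, Submodule.mem_orthogonal]
  rintro _ ⟨a, rfl⟩
  have h3 := DFunLike.congr_fun h2 a
  rw [real_inner_comm]
  rw [← neg_eq_zero]
  simpa [inner_sub_left] using h3

/-- The vector `k` is the projection of `n` onto `N_y M`, continuous in `y ∈ M`. -/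
theorem IsCkSubmanifold.exists_mem_of_mem_normalFibers (hM : IsCkSubmanifold 1 m M)
    (hKM : K ⊆ M) {z n : EuclideanSpace ℝ (Fin d)} (hz : z ∈ K) (hn : n ∈ normalSpace M z)
    {O : Set (EuclideanSpace ℝ (Fin d))} (hO : IsOpen O) (hzO : z + n ∈ O) :
    ∃ W, IsOpen W ∧ z ∈ W ∧ ∀ y ∈ M ∩ W, ∃ k ∈ normalSpace M y, y + k ∈ O := by
  have hg : ContinuousOn (fun y => y + (normalSpace M y).starProjection n) M :=
    continuousOn_id.add (hM.continuousOn_starProjection_normalSpace.clm_apply continuousOn_const)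
  have h1 : z + (normalSpace M z).starProjection n ∈ O := by
    rwa [Submodule.starProjection_eq_self_iff.2 hn]
  obtain ⟨W, hW, hzW, h⟩ := mem_nhdsWithin.1 ((hg z (hKM hz)).eventually (hO.mem_nhds h1))
  exact ⟨W, hW, hzW, fun y hy => ⟨_, Submodule.starProjection_apply_mem _ _, h ⟨hy.2, hy.1⟩⟩⟩

theorem LocalParam.exists_mem_interior_normalFibers (L : LocalParam 2 m M)
    {u : EuclideanSpace ℝ (Fin m)} (hu : u ∈ L.V) (hK : ∀ᶠ v in nhds u, L.φ v ∈ K)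
    {n : EuclideanSpace ℝ (Fin d)} (hn : n ∈ normalSpace M (L.φ u))
    {O : Set (EuclideanSpace ℝ (Fin d))} (hO : IsOpen O) (hnO : L.φ u + n ∈ O) :
    ∃ x ∈ O, x ∈ interior (normalFibers M K) := by
  rw [← L.range_frame hu] at hn
  obtain ⟨t, rfl⟩ := hn
  have h1 : {s : ℝ | L.endpoint (u, s • t) ∈ O} ∈ nhds (1 : ℝ) := by
    have hc : Continuous fun s : ℝ => L.endpoint (u, s • t) := by
      simp only [endpoint]
      fun_prop
    refine (hO.preimage hc).mem_nhds ?_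
    simpa [endpoint] using hnO
  -- The given point has parameter `s = 1` and may be focal; a nearby `s` avoids the finitely many
  -- focal values.
  obtain ⟨s, hsO, hs⟩ := ((infinite_of_mem_nhds _ h1).sdiff
    (L.finite_setOf_not_bijective_fderiv_endpoint hu t)).nonempty
  have hbij : Function.Bijective (fderiv ℝ L.endpoint (u, s • t)) := not_not.1 hs
  refine ⟨_, hsO, mem_interior_iff_mem_nhds.2 ?_⟩
  have hst : HasStrictFDerivAt L.endpoint (fderiv ℝ L.endpoint (u, s • t)) (u, s • t) :=
    (L.contDiffOn_endpoint.contDiffAt (L.isOpen_prod.mem_nhds ⟨hu, trivial⟩)).hasStrictFDerivAt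
      one_ne_zero
  rw [← hst.map_nhds_eq_of_surj (LinearMap.range_eq_top.2 hbij.2), Filter.mem_map]
  filter_upwards [(continuous_fst.tendsto (u, s • t)).eventually hK,
    (continuous_fst.tendsto (u, s • t)).eventually (L.isOpen_V.mem_nhds hu)] with p hp hpV
  exact ⟨_, hp, _, L.range_frame hpV ▸ ⟨p.2, rfl⟩, rfl⟩

end normalFibers

/-! ### The perturbed distribution -/

section perturbedLaw

variable {d m : ℕ} {M : Set (EuclideanSpace ℝ (Fin d))}
  {ν : Measure (EuclideanSpace ℝ (Fin d))} {σ : ℝ}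

theorem isProbabilityMeasure_perturbedLaw (hM : IsCkSubmanifold 1 m M) (hmeas : MeasurableSet M)
    [IsProbabilityMeasure ν] (hν : ∀ᵐ z ∂ν, z ∈ M) :
    IsProbabilityMeasure (perturbedLaw M ν σ) := by
  refine ⟨?_⟩
  rw [perturbedLaw, Measure.bind_apply .univ (aemeasurable_normalFiberGaussian hM hmeas σ hν)]
  simp

/-- Only the upper bound for `bind` is needed, which requires no measurability of the kernel. -/
theorem perturbedLaw_eq_zero {B : Set (EuclideanSpace ℝ (Fin d))} (hB : MeasurableSet B)
    (h : ∀ᵐ z ∂ν, normalFiberGaussian M σ z B = 0) : perturbedLaw M ν σ B = 0 := by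
  refine le_antisymm ((Measure.bind_apply_le _ hB).trans ?_) zero_le
  rw [lintegral_congr_ae h, lintegral_zero]

theorem perturbedLaw_absolutelyContinuous (hM : IsCkSubmanifold 2 m M) (hmeas : MeasurableSet M)
    (hν : ν ≪ (Measure.hausdorffMeasure (m : ℝ)).restrict M) (hσ : σ ≠ 0) :
    perturbedLaw M ν σ ≪ volume := by
  refine Measure.AbsolutelyContinuous.mk fun B hB hB0 => ?_
  exact perturbedLaw_eq_zero hB (hν.ae_le (hM.ae_normalFiberGaussian_eq_zero hmeas hB hB0 hσ))

theorem support_perturbedLaw (hM : IsCkSubmanifold 1 m M) (hMc : IsCompact M)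
    (hν : ∀ᵐ z ∂ν, z ∈ M) (hσ : σ ≠ 0) :
    (perturbedLaw M ν σ).support = normalFibers M ν.support := by
  have hsub : ν.support ⊆ M := Measure.support_subset_of_isClosed hMc.isClosed hν
  apply subset_antisymm
  · have hcl : IsClosed (normalFibers M ν.support) :=
      hM.isClosed_normalFibers (hMc.of_isClosed_subset Measure.isClosed_support hsub) hsub
    refine Measure.support_subset_of_isClosed hcl
      (perturbedLaw_eq_zero hcl.measurableSet.compl ?_)
    filter_upwards [Measure.support_mem_ae (μ := ν)] with z hz
    rw [← mem_ae_iff]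
    filter_upwards [normalFiberGaussian_ae_mem M σ z] with x hx
    exact mem_normalFibers.2 ⟨z, hz, hx⟩
  · rintro _ ⟨z, hz, n, hn, rfl⟩
    rw [Measure.mem_support_iff_forall]
    intro N hN
    obtain ⟨O, hON, hO, hzO⟩ := mem_nhds_iff.1 hN
    refine lt_of_lt_of_le (pos_iff_ne_zero.2 fun h0 => ?_) (measure_mono hON)
    obtain ⟨W, hW, hzW, h⟩ := hM.exists_mem_of_mem_normalFibers hsub hz hn hO hzO
    have hae := aemeasurable_normalFiberGaussian hM hMc.measurableSet σ hν
    rw [perturbedLaw, Measure.bind_apply hO.measurableSet hae] at h0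
    have h0' := (lintegral_eq_zero_iff'
      ((Measure.measurable_coe hO.measurableSet).comp_aemeasurable hae)).1 h0
    refine ((Measure.mem_support_iff_forall z).1 hz W (hW.mem_nhds hzW)).ne' ?_
    rw [← compl_mem_ae_iff]
    filter_upwards [h0', hν] with y hy hyM hyW
    obtain ⟨k, hk, hkO⟩ := h y ⟨hyM, hyW⟩
    exact (normalFiberGaussian_pos_of_isOpen hσ hk hO hkO).ne' hy

end perturbedLaw

theorem normalFibers_support_dataLaw_subset_closure_interior {d m : ℕ}
    {M : Set (EuclideanSpace ℝ (Fin d))} {p₀ : EuclideanSpace ℝ (Fin d) → ℝ}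
    (hM : IsCkSubmanifold 2 m M) (hMc : IsCompact M) (hp₀ : ContinuousOn p₀ M) :
    normalFibers M (dataLaw m M p₀).support ⊆
      closure (interior (normalFibers M (dataLaw m M p₀).support)) := by
  have hM1 : IsCkSubmanifold 1 m M := hM.of_le (by norm_num)
  rintro _ ⟨z, hz, n, hn, rfl⟩
  rw [mem_closure_iff]
  intro O hO hzO
  obtain ⟨W, hW, hzW, h⟩ := hM1.exists_mem_of_mem_normalFibers
    (support_dataLaw_subset hMc.isClosed) hz hn hO hzO
  obtain ⟨y, hy, hpos⟩ := exists_pos_of_mem_support_dataLaw hMc.measurableSet hz hW hzW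
  obtain ⟨k, hk, hkO⟩ := h y hy
  -- The base point has been moved from `z`, where `p₀` may vanish, to `y` with `p₀ y > 0`; there a
  -- whole neighborhood in `M` lies in the support.
  obtain ⟨L, hL⟩ := hM.exists_localParam (by norm_num) hy.1
  obtain ⟨u, hu, rfl⟩ : y ∈ L.φ '' L.V := L.image_eq ▸ ⟨hy.1, hL⟩
  refine L.exists_mem_interior_normalFibers hu ?_ hk hO hkO
  have h1 : Filter.Tendsto L.φ (nhds u) (nhdsWithin (L.φ u) M) := by
    refine tendsto_nhdsWithin_iff.2 ⟨(L.hasFDerivAt_φ hu).continuousAt, ?_⟩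
    filter_upwards [L.isOpen_V.mem_nhds hu] with v hv using (L.φ_mem hv).1
  filter_upwards [h1.eventually ((hp₀ _ hy.1).eventually (lt_mem_nhds hpos)),
    L.isOpen_V.mem_nhds hu] with v hv hvV
  exact mem_support_dataLaw_of_pos hM1 hMc.measurableSet hp₀ (L.φ_mem hvV).1 hv

theorem mainTheorem4 (d m : ℕ) (M : Set (EuclideanSpace ℝ (Fin d)))
    (hM : IsCompact M) (hM2 : IsCkSubmanifold 2 m M)
    (p₀ : EuclideanSpace ℝ (Fin d) → ℝ) (hp₀ : ∀ x ∈ M, 0 ≤ p₀ x)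
    (hLip : ∃ L : ℝ≥0, LipschitzOnWith L p₀ M)
    (hprob : IsProbabilityMeasure (dataLaw m M p₀))
    (σ : ℝ) (hσ : 0 < σ) :
    -- `p_σ` is a probability measure with a Lebesgue density
    IsProbabilityMeasure (perturbedLaw M (dataLaw m M p₀) σ) ∧
    perturbedLaw M (dataLaw m M p₀) σ ≪ volume ∧
    -- it is not supported on, and does not even charge, a lower-dimensional manifold
    (∀ j < d, ∀ S : Set (EuclideanSpace ℝ (Fin d)), IsCkSubmanifold 1 j S →
      perturbedLaw M (dataLaw m M p₀) σ S = 0 ∧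
      ¬ (perturbedLaw M (dataLaw m M p₀) σ).support ⊆ S) ∧
    -- its support consists of the affine normal fibers over the support of `p₀`
    (perturbedLaw M (dataLaw m M p₀) σ).support =
      {x | ∃ z ∈ (dataLaw m M p₀).support, ∃ n ∈ normalSpace M z, x = z + n} ∧
    -- and is `d`-dimensional everywhere: it is the closure of its interior
    (perturbedLaw M (dataLaw m M p₀) σ).support =
      closure (interior (perturbedLaw M (dataLaw m M p₀) σ).support) ∧
    -- if `p₀` is fully supported on `M`, then `p_σ` is fully supported on the ambient space
    ((dataLaw m M p₀).support = M →
      (perturbedLaw M (dataLaw m M p₀) σ).support = Set.univ) := by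
  obtain ⟨K, hK⟩ := hLip
  have hM1 : IsCkSubmanifold 1 m M := hM2.of_le (by norm_num)
  have hae : ∀ᵐ z ∂dataLaw m M p₀, z ∈ M := ae_mem_dataLaw hM.measurableSet
  have hP : IsProbabilityMeasure (perturbedLaw M (dataLaw m M p₀) σ) :=
    isProbabilityMeasure_perturbedLaw hM1 hM.measurableSet hae
  have hac : perturbedLaw M (dataLaw m M p₀) σ ≪ volume :=
    perturbedLaw_absolutelyContinuous hM2 hM.measurableSet dataLaw_absolutelyContinuous hσ.ne'
  have hsupp := support_perturbedLaw (ν := dataLaw m M p₀) hM1 hM hae hσ.ne'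
  refine ⟨hP, hac, fun j hj S hS => ?_, hsupp, ?_, fun h => ?_⟩
  · have h0 := hac (hS.volume_eq_zero hj)
    refine ⟨h0, fun hsub => ?_⟩
    have h1 := measure_union_null (measure_mono_null hsub h0) Measure.measure_compl_support
    rw [Set.union_compl_self, measure_univ] at h1
    exact one_ne_zero h1
  · apply subset_antisymm
    · rw [hsupp]
      exact normalFibers_support_dataLaw_subset_closure_interior hM2 hM hK.continuousOn
    · exact Measure.isClosed_support.closure_interior_subset
  · rw [hsupp, h]
    -- `M` is nonempty because it carries a probability measure.
    exact hM1.normalFibers_eq_univ hM hae.exists
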